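/- A rotated polynomial graph is a set $\{(x,y)\in\mathbb{R}^2 : p(\cos\theta\, x+\sin\theta\, y)=-\sin\theta\, x+\cos\theta\, y\}$, where $p$ is a real polynomial in one variable and $\theta\in\mathbb{R}$. A closed arc is the part of such a graph lying over a closed interval (bounded or unbounded, with more than one point) of the variable $\cos\theta\, x+\sin\theta\, y$. A region of type I is a closed, simply connected set $T\subseteq\mathbb{R}^2$ whose boundary is the union of finitely many closed arcs, called its sides; $T$ may be unbounded and its boundary may be disconnected. A region of type II is a set $X=T\setminus\partial T$ with $T$ a region of type I; its sides are those of $T$. Proposition 4.8. Let $X_1,\dots,X_n$ be regions of type II. Then $X_1\cup\dots\cup X_n$ is a disjoint union of finitely many open connected sets such that, for each of these sets $U$, the boundary $\partial U$ has finitely many connected components, and each component of $\partial U$ is either (a) a finite union of closed arcs, each of which is contained in $\partial X_i$ and in a side of $X_i$ for some $i$; or (b) a single point belonging to $\partial X_i\cap\partial X_j$ for some $i\neq j$. -/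

import Mathlib

/-- The curve `{(x, y) | p (cos θ x + sin θ y) = - sin θ x + cos θ y}`, that is, the graph of the
polynomial function `p` rotated by the angle `θ`, parametrized by the abscissa `t` in the rotated
coordinate frame. -/
noncomputable def polyCurve (θ : ℝ) (p : Polynomial ℝ) (t : ℝ) : ℝ × ℝ :=
  (Real.cos θ * t - Real.sin θ * p.eval t, Real.sin θ * t + Real.cos θ * p.eval t)

/-- A closed arc of a rotated polynomial graph: the part of the graph over a closed interval `I`,
bounded or unbounded, with more than one point. -/
def IsPolyArc (A : Set (ℝ × ℝ)) : Prop :=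
  ∃ (θ : ℝ) (p : Polynomial ℝ) (I : Set ℝ),
    I.OrdConnected ∧ IsClosed I ∧ I.Nontrivial ∧ A = polyCurve θ p '' I

/-- `T` is a region of type I with set of sides `𝒮`: a closed simply connected subset of the plane
whose boundary is the union of finitely many sides, each of them a closed arc of a rotated
polynomial graph. The region and its boundary may be bounded or unbounded, and the boundary need
not be connected. -/
structure IsTypeI (T : Set (ℝ × ℝ)) (𝒮 : Set (Set (ℝ × ℝ))) : Prop where
  isClosed : IsClosed T
  simplyConnected : IsSimplyConnected T
  finite_sides : 𝒮.Finite
  isPolyArc_of_mem : ∀ S ∈ 𝒮, IsPolyArc S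
  frontier_eq : frontier T = ⋃₀ 𝒮

/-- `X` is a region of type II with set of sides `𝒮`: a region of type I with these sides, without
its boundary. -/
def IsTypeII (X : Set (ℝ × ℝ)) (𝒮 : Set (Set (ℝ × ℝ))) : Prop :=
  ∃ T : Set (ℝ × ℝ), IsTypeI T 𝒮 ∧ X = T \ frontier T

/-- The connected components of a subset `B` of the plane, as a set of subsets. -/
def componentsOf (B : Set (ℝ × ℝ)) : Set (Set (ℝ × ℝ)) :=
  {C | ∃ x ∈ B, C = connectedComponentIn B x}

/-! The sets required are the connected components `U` of the union. A frontier point of `U` lies in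
no region, so `frontier U` lies in the union `F` of all sides. Two arcs meet in finitely many points
and intervals, so `F` splits into finitely many vertices and finitely many open edges, each edge
relatively open in `F` and inside or disjoint from each side (`exists_polyEdge_decomposition`).

Each edge has two connected one-sided collars off `F` (`IsPolyEdge.exists_collars`), and a set whose
frontier lies in `F` contains or misses each collar. Hence a component whose closure meets an edge
swallows one of its collars, while one whose frontier consists of vertices contains the complement
of the vertices. Disjointness leaves finitely many components.

The collar swallowed by `U` lies in a single `X i`, so an edge meeting `frontier U` lies wholly in
it, in `frontier (X i)` and in a side of `X i` (`IsPolyEdge.exists_frontier_side`). Thus `frontier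
U` is a finite union of closed arcs and vertices, and each of its components is a union of arcs or
one isolated vertex. If only one region accumulated at such a vertex, it would fill a punctured ball
around it and, being the interior of a closed set, contain it
(`exists_mem_frontier_inter_frontier`). -/

open Set Topology Metric

/-! ### Frontiers of intervals and of their polynomial preimages -/

/-- A preconnected set that misses the frontier of `t` lies inside `t` or is disjoint from it. -/
theorem IsPreconnected.subset_or_disjoint_of_disjoint_frontier {α : Type*} [TopologicalSpace α]
    {s t : Set α} (hs : IsPreconnected s) (h : Disjoint s (frontier t)) :
    s ⊆ t ∨ Disjoint s t := by
  have hcov : s ⊆ interior t ∪ (closure t)ᶜ := fun x hx => by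
    by_contra hc
    simp only [mem_union, mem_compl_iff, not_or, not_not] at hc
    exact h.notMem_of_mem_left hx ⟨hc.2, hc.1⟩
  have hdis : Disjoint (interior t) (closure t)ᶜ :=
    disjoint_compl_right.mono_left (interior_subset.trans subset_closure)
  rcases (s ∩ interior t).eq_empty_or_nonempty with he | hne
  · right
    refine disjoint_left.2 fun x hx hxt => ?_
    rcases hcov hx with h1 | h1
    · exact (eq_empty_iff_forall_notMem.1 he x) ⟨hx, h1⟩
    · exact h1 (subset_closure hxt)
  · left
    exact (hs.subset_left_of_subset_union isOpen_interior isClosed_closure.isOpen_compl hdis hcov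
      hne).trans interior_subset

/-- A frontier point with points of `I` strictly on both sides would be interior, so only a supremum
and an infimum remain. -/
theorem Set.OrdConnected.finite_frontier {I : Set ℝ} (hI : I.OrdConnected) :
    (frontier I).Finite := by
  have hsub : frontier I ⊆ {x | IsLUB I x} ∪ {x | IsGLB I x} := by
    intro x hx
    by_cases hu : x ∈ upperBounds I
    · exact Or.inl (isLUB_of_mem_closure hu hx.1)
    by_cases hl : x ∈ lowerBounds I
    · exact Or.inr (isGLB_of_mem_closure hl hx.1)
    simp only [mem_upperBounds, mem_lowerBounds, not_forall, not_le, exists_prop] at hu hl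
    obtain ⟨b, hb, hxb⟩ := hu
    obtain ⟨a, ha, hax⟩ := hl
    exact absurd (mem_interior_iff_mem_nhds.2
      (Filter.mem_of_superset (Icc_mem_nhds hax hxb) (hI.out ha hb))) hx.2
  refine Finite.subset (Finite.union ?_ ?_) hsub
  · exact Set.Subsingleton.finite fun a ha b hb => IsLUB.unique ha hb
  · exact Set.Subsingleton.finite fun a ha b hb => IsGLB.unique ha hb

theorem Polynomial.finite_frontier_preimage (q : Polynomial ℝ) {I : Set ℝ}
    (hI : (frontier I).Finite) : (frontier {t | q.eval t ∈ I}).Finite := by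
  by_cases hq : q.degree ≤ 0
  · rw [Polynomial.eq_C_of_degree_le_zero hq]
    simp only [Polynomial.eval_C]
    by_cases h : q.coeff 0 ∈ I <;> simp [h]
  · refine Finite.subset (s := ⋃ y ∈ frontier I, {t | (q - Polynomial.C y).IsRoot t}) ?_ ?_
    · refine hI.biUnion fun y _ => Polynomial.finite_setOfPred_isRoot ?_
      intro h0
      rw [sub_eq_zero] at h0
      exact hq (h0 ▸ Polynomial.degree_C_le)
    · intro t ht
      have := q.continuous.frontier_preimage_subset I ht
      simp only [mem_iUnion]
      exact ⟨q.eval t, this, by simp [Polynomial.IsRoot]⟩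

/-! ### Rotated coordinates and intersections of arcs -/

/-- The coordinate along the rotated abscissa axis. -/
noncomputable def rotFst (θ : ℝ) (z : ℝ × ℝ) : ℝ := Real.cos θ * z.1 + Real.sin θ * z.2

/-- The coordinate along the rotated ordinate axis. -/
noncomputable def rotSnd (θ : ℝ) (z : ℝ × ℝ) : ℝ := -Real.sin θ * z.1 + Real.cos θ * z.2

/-- The point with given rotated coordinates. -/
noncomputable def rotPoint (θ t y : ℝ) : ℝ × ℝ :=
  (Real.cos θ * t - Real.sin θ * y, Real.sin θ * t + Real.cos θ * y)

theorem rotFst_rotPoint (θ t y : ℝ) : rotFst θ (rotPoint θ t y) = t := by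
  simp only [rotFst, rotPoint]; linear_combination t * Real.sin_sq_add_cos_sq θ

theorem rotSnd_rotPoint (θ t y : ℝ) : rotSnd θ (rotPoint θ t y) = y := by
  simp only [rotSnd, rotPoint]; linear_combination y * Real.sin_sq_add_cos_sq θ

theorem rotPoint_rot (θ : ℝ) (z : ℝ × ℝ) : rotPoint θ (rotFst θ z) (rotSnd θ z) = z := by
  ext
  · simp only [rotFst, rotSnd, rotPoint]; linear_combination z.1 * Real.sin_sq_add_cos_sq θ
  · simp only [rotFst, rotSnd, rotPoint]; linear_combination z.2 * Real.sin_sq_add_cos_sq θ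

theorem polyCurve_eq_rotPoint (θ : ℝ) (p : Polynomial ℝ) (t : ℝ) :
    polyCurve θ p t = rotPoint θ t (p.eval t) := rfl

theorem rotFst_polyCurve (θ : ℝ) (p : Polynomial ℝ) (t : ℝ) : rotFst θ (polyCurve θ p t) = t :=
  rotFst_rotPoint _ _ _

@[fun_prop]
theorem continuous_rotFst (θ : ℝ) : Continuous (rotFst θ) := by unfold rotFst; fun_prop

@[fun_prop]
theorem continuous_rotSnd (θ : ℝ) : Continuous (rotSnd θ) := by unfold rotSnd; fun_prop

@[fun_prop]
theorem continuous_polyCurve (θ : ℝ) (p : Polynomial ℝ) : Continuous (polyCurve θ p) := by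
  unfold polyCurve; fun_prop

theorem polyCurve_injective (θ : ℝ) (p : Polynomial ℝ) : Function.Injective (polyCurve θ p) :=
  Function.LeftInverse.injective (rotFst_polyCurve θ p)

theorem isClosed_image_polyCurve (θ : ℝ) (p : Polynomial ℝ) {I : Set ℝ} (hI : IsClosed I) :
    IsClosed (polyCurve θ p '' I) :=
  (Function.LeftInverse.isClosedEmbedding
    (f := rotFst θ) (rotFst_polyCurve θ p) (continuous_rotFst θ)
    (continuous_polyCurve θ p)).isClosedMap _ hI

theorem mem_image_polyCurve {θ : ℝ} {p : Polynomial ℝ} {I : Set ℝ} {z : ℝ × ℝ} :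
    z ∈ polyCurve θ p '' I ↔ rotFst θ z ∈ I ∧ rotSnd θ z = p.eval (rotFst θ z) := by
  constructor
  · rintro ⟨t, ht, rfl⟩
    rw [rotFst_polyCurve]
    exact ⟨ht, rotSnd_rotPoint _ _ _⟩
  · rintro ⟨h1, h2⟩
    exact ⟨_, h1, by rw [polyCurve_eq_rotPoint, ← h2, rotPoint_rot]⟩

theorem IsPolyArc.isClosed {A : Set (ℝ × ℝ)} (hA : IsPolyArc A) : IsClosed A := by
  obtain ⟨θ, p, I, -, hI, -, rfl⟩ := hA
  exact isClosed_image_polyCurve θ p hI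

theorem IsPolyArc.isConnected {A : Set (ℝ × ℝ)} (hA : IsPolyArc A) : IsConnected A := by
  obtain ⟨θ, p, I, hI, -, hn, rfl⟩ := hA
  exact ⟨hn.nonempty.image _, hI.isPreconnected.image _ (continuous_polyCurve θ p).continuousOn⟩

theorem finite_frontier_inter {α : Type*} [TopologicalSpace α] {s t : Set α}
    (hs : (frontier s).Finite) (ht : (frontier t).Finite) : (frontier (s ∩ t)).Finite :=
  ((hs.inter_of_left _).union (ht.inter_of_right _)).subset (frontier_inter_subset s t)

/-- In the rotated frame of `A` the curve has polynomial coordinates `a` and `b`, so lying on `A` is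
an interval condition on `a` together with a polynomial equation. Arcs may overlap, so it is the
frontier of the parameter set that is finite, not the set itself. -/
theorem IsPolyArc.finite_frontier_preimage {A : Set (ℝ × ℝ)} (hA : IsPolyArc A) (θ : ℝ)
    (p : Polynomial ℝ) : (frontier {t | polyCurve θ p t ∈ A}).Finite := by
  obtain ⟨φ, q, I, hI, -, -, rfl⟩ := hA
  open Polynomial in
  let x : Polynomial ℝ := C (Real.cos θ) * X - C (Real.sin θ) * p
  open Polynomial in
  let y : Polynomial ℝ := C (Real.sin θ) * X + C (Real.cos θ) * p
  open Polynomial in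
  let a : Polynomial ℝ := C (Real.cos φ) * x + C (Real.sin φ) * y
  open Polynomial in
  let b : Polynomial ℝ := -C (Real.sin φ) * x + C (Real.cos φ) * y
  have ha (t : ℝ) : rotFst φ (polyCurve θ p t) = a.eval t := by
    simp [rotFst, polyCurve, a, x, y]
  have hb (t : ℝ) : rotSnd φ (polyCurve θ p t) = b.eval t := by
    simp [rotSnd, polyCurve, b, x, y]
  have : {t | polyCurve θ p t ∈ polyCurve φ q '' I} =
      {t | a.eval t ∈ I} ∩ {t | (b - q.comp a).eval t ∈ ({0} : Set ℝ)} := by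
    ext t
    simp only [mem_ofPred_eq, mem_image_polyCurve, ha, hb, mem_inter_iff, mem_singleton_iff,
      Polynomial.eval_sub, Polynomial.eval_comp, sub_eq_zero]
  rw [this]
  exact finite_frontier_inter (a.finite_frontier_preimage hI.finite_frontier)
    ((b - q.comp a).finite_frontier_preimage ordConnected_singleton.finite_frontier)

/-! ### Cutting the sides into vertices and edges -/

/-- An open arc of a rotated polynomial graph that is relatively open in the union of the finite
family of arcs `𝒮` and is contained in or disjoint from each member. -/
structure IsPolyEdge (𝒮 : Set (Set (ℝ × ℝ))) (θ : ℝ) (p : Polynomial ℝ) (J : Set ℝ) : Prop where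
  isOpen : IsOpen J
  ordConnected : J.OrdConnected
  nonempty : J.Nonempty
  isClosed_sdiff : IsClosed (⋃₀ 𝒮 \ polyCurve θ p '' J)
  subset_or_disjoint : ∀ S ∈ 𝒮, polyCurve θ p '' J ⊆ S ∨ Disjoint (polyCurve θ p '' J) S

/-- The set of reals lying above all points of `Q` and below all points of `P \ Q`. -/
def cutInterval (P Q : Set ℝ) : Set ℝ := (⋂ x ∈ Q, Ioi x) ∩ ⋂ x ∈ P \ Q, Iio x

theorem isOpen_cutInterval {P Q : Set ℝ} (hP : P.Finite) (hQ : Q ⊆ P) :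
    IsOpen (cutInterval P Q) :=
  ((hP.subset hQ).isOpen_biInter fun _ _ => isOpen_Ioi).inter
    (hP.sdiff.isOpen_biInter fun _ _ => isOpen_Iio)

theorem ordConnected_cutInterval (P Q : Set ℝ) : (cutInterval P Q).OrdConnected :=
  (ordConnected_biInter fun _ _ => ordConnected_Ioi).inter
    (ordConnected_biInter fun _ _ => ordConnected_Iio)

theorem disjoint_cutInterval (P Q : Set ℝ) : Disjoint (cutInterval P Q) P := by
  refine disjoint_left.2 fun x hx hxP => ?_
  simp only [cutInterval, mem_inter_iff, mem_iInter, mem_Ioi, mem_Iio] at hx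
  by_cases hxQ : x ∈ Q
  · exact lt_irrefl _ (hx.1 x hxQ)
  · exact lt_irrefl _ (hx.2 x ⟨hxP, hxQ⟩)

theorem mem_cutInterval_of_notMem {P : Set ℝ} {x : ℝ} (hx : x ∉ P) :
    x ∈ cutInterval P {y ∈ P | y < x} := by
  simp only [cutInterval, mem_inter_iff, mem_iInter, mem_Ioi, mem_Iio]
  refine ⟨fun y hy => hy.2, fun y hy => ?_⟩
  have h1 : ¬ y < x := fun h => hy.2 ⟨hy.1, h⟩
  exact lt_of_le_of_ne (not_lt.1 h1) fun h => hx (h ▸ hy.1)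

/-- Vertices are the points where an arc starts or stops lying on some arc of the family, itself
included; edges are the pieces of arcs between consecutive vertices. -/
theorem exists_polyEdge_decomposition {𝒮 : Set (Set (ℝ × ℝ))} (h𝒮 : 𝒮.Finite)
    (harc : ∀ S ∈ 𝒮, IsPolyArc S) :
    ∃ (V : Set (ℝ × ℝ)) (ℰ : Set (Set (ℝ × ℝ))), V.Finite ∧ ℰ.Finite ∧ ⋃₀ 𝒮 ⊆ V ∪ ⋃₀ ℰ ∧
      ∀ e ∈ ℰ, ∃ θ p J, e = polyCurve θ p '' J ∧ IsPolyEdge 𝒮 θ p J := by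
  choose! θ p I hI hIc hIn hS using harc
  let γ (S : Set (ℝ × ℝ)) := polyCurve (θ S) (p S)
  let K (S S' : Set (ℝ × ℝ)) : Set ℝ := I S ∩ {t | γ S t ∈ S'}
  have hSS {S} (h : S ∈ 𝒮) : IsPolyArc S := ⟨θ S, p S, I S, hI S h, hIc S h, hIn S h, hS S h⟩
  have hK {S S'} (h : S ∈ 𝒮) (h' : S' ∈ 𝒮) : (frontier (K S S')).Finite :=
    finite_frontier_inter (hI S h).finite_frontier ((hSS h').finite_frontier_preimage _ _)
  let V : Set (ℝ × ℝ) := ⋃ S ∈ 𝒮, ⋃ S' ∈ 𝒮, γ S '' frontier (K S S')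
  have hV : V.Finite := h𝒮.biUnion fun S h => h𝒮.biUnion fun S' h' => (hK h h').image _
  -- All of `V` is pulled back, so that an edge of `S` also avoids the vertices produced by other
  -- arcs; relative openness of edges relies on this.
  let P (S : Set (ℝ × ℝ)) : Set ℝ := γ S ⁻¹' V
  have hP (S) : (P S).Finite := hV.preimage (polyCurve_injective _ _).injOn
  have hKP {S S'} (h : S ∈ 𝒮) (h' : S' ∈ 𝒮) : frontier (K S S') ⊆ P S := fun t ht =>
    mem_biUnion h (mem_biUnion h' (mem_image_of_mem _ ht))
  have hKS {S} (h : S ∈ 𝒮) : K S S = I S := by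
    refine inter_eq_left.2 fun t ht => ?_
    exact (hS S h).symm.subset (mem_image_of_mem (γ S) ht)
  let ℰ : Set (Set (ℝ × ℝ)) := ⋃ S ∈ 𝒮, (fun Q => γ S '' cutInterval (P S) Q) ''
    {Q | Q ⊆ P S ∧ (cutInterval (P S) Q).Nonempty ∧ cutInterval (P S) Q ⊆ I S}
  refine ⟨V, ℰ, hV, ?_, ?_, ?_⟩
  · exact h𝒮.biUnion fun S _ => ((hP S).finite_subsets.subset fun Q hQ => hQ.1).image _
  · rintro z ⟨S, h, hz⟩
    by_cases hzV : z ∈ V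
    · exact Or.inl hzV
    right
    have hz' := hz
    rw [hS S h] at hz'
    obtain ⟨t, ht, rfl⟩ := hz'
    have htP : t ∉ P S := hzV
    have hmem := mem_cutInterval_of_notMem htP
    refine ⟨_, mem_biUnion h ⟨{y ∈ P S | y < t}, ?_, rfl⟩, mem_image_of_mem _ hmem⟩
    refine ⟨fun y hy => hy.1, ⟨t, hmem⟩, ?_⟩
    refine ((ordConnected_cutInterval _ _).isPreconnected.subset_or_disjoint_of_disjoint_frontier
      (t := I S) ?_).resolve_right fun hd => disjoint_left.1 hd hmem ht
    exact (disjoint_cutInterval _ _).mono_right (hKS h ▸ hKP h h)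
  · intro e he
    simp only [ℰ, mem_iUnion] at he
    obtain ⟨S, h, Q, ⟨hQ, hne, hJI⟩, rfl⟩ := he
    have hJP := disjoint_cutInterval (P S) Q
    have hJo := isOpen_cutInterval (hP S) hQ
    have hJc := ordConnected_cutInterval (P S) Q
    set J := cutInterval (P S) Q
    have heS : γ S '' J ⊆ S := by
      conv_rhs => rw [hS S h]
      exact image_mono hJI
    refine ⟨θ S, p S, J, rfl, hJo, hJc, hne, ?_, ?_⟩
    · simp only [sUnion_eq_biUnion, Set.sdiff_eq, iUnion₂_inter]
      refine h𝒮.isClosed_biUnion fun S' h' => ?_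
      -- The interior may replace `K S' S` because a frontier parameter would give a vertex on the
      -- edge. What remains of `S'` is then the image of a closed parameter set.
      have hset : S' ∩ (γ S '' J)ᶜ =
          γ S' '' (I S' \ (interior (K S' S) ∩ {t | rotFst (θ S) (γ S' t) ∈ J})) := by
        ext z
        constructor
        · rintro ⟨hz, hze⟩
          rw [hS S' h'] at hz
          obtain ⟨t, ht, rfl⟩ := hz
          refine ⟨t, ⟨ht, fun hc => hze ?_⟩, rfl⟩
          have h1 : γ S' t ∈ S := (interior_subset hc.1).2
          rw [hS S h] at h1
          exact mem_image_polyCurve.2 ⟨hc.2, (mem_image_polyCurve.1 h1).2⟩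
        · rintro ⟨t, ⟨ht, hnt⟩, rfl⟩
          refine ⟨(hS S' h').symm.subset (mem_image_of_mem (γ S') ht), fun hze => hnt ⟨?_, ?_⟩⟩
          · by_contra hni
            have hfr : t ∈ frontier (K S' S) := ⟨subset_closure ⟨ht, heS hze⟩, hni⟩
            obtain ⟨u, hu, hut⟩ := hze
            refine disjoint_left.1 hJP hu ?_
            change γ S u ∈ V
            rw [hut]
            exact hKP h' h hfr
          · exact (mem_image_polyCurve.1 hze).1
      rw [show polyCurve (θ S) (p S) '' J = γ S '' J from rfl, hset]
      refine isClosed_image_polyCurve _ _ ((hIc S' h').sdiff (isOpen_interior.inter ?_))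
      exact hJo.preimage ((continuous_rotFst _).comp (continuous_polyCurve _ _))
    · intro S' h'
      rcases hJc.isPreconnected.subset_or_disjoint_of_disjoint_frontier (t := K S S')
        (hJP.mono_right (hKP h h')) with hc | hc
      · left
        rintro _ ⟨t, ht, rfl⟩
        exact (hc ht).2
      · right
        refine disjoint_left.2 ?_
        rintro _ ⟨t, ht, rfl⟩ hz
        exact disjoint_left.1 hc ht ⟨hJI ht, hz⟩

/-! ### One-sided collars of edges -/

/-- A closed set admits a continuous function that is positive off the set, such that the ball
around each point with this radius avoids the set. -/
theorem IsClosed.exists_continuous_radius {α : Type*} [PseudoMetricSpace α] {s : Set α}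
    (hs : IsClosed s) :
    ∃ d : α → ℝ, Continuous d ∧ (∀ x ∉ s, 0 < d x) ∧ ∀ x, ∀ y ∈ s, d x ≤ dist y x := by
  rcases s.eq_empty_or_nonempty with rfl | hne
  · exact ⟨fun _ => 1, continuous_const, by simp, by simp⟩
  · refine ⟨fun x => infDist x s, continuous_infDist_pt s,
      fun x hx => (hs.notMem_iff_infDist_pos hne).1 hx, fun x y hy => ?_⟩
    rw [dist_comm]
    exact infDist_le_dist_of_mem hy

theorem dist_rotPoint_le (θ t y y' : ℝ) : dist (rotPoint θ t y) (rotPoint θ t y') ≤ |y - y'| := by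
  rw [Prod.dist_eq, max_le_iff]
  simp only [rotPoint, Real.dist_eq]
  constructor
  · rw [show Real.cos θ * t - Real.sin θ * y - (Real.cos θ * t - Real.sin θ * y') =
      -Real.sin θ * (y - y') by ring, abs_mul, abs_neg]
    exact mul_le_of_le_one_left (abs_nonneg _) (Real.abs_sin_le_one θ)
  · rw [show Real.sin θ * t + Real.cos θ * y - (Real.sin θ * t + Real.cos θ * y') =
      Real.cos θ * (y - y') by ring, abs_mul]
    exact mul_le_of_le_one_left (abs_nonneg _) (Real.abs_cos_le_one θ)

/-- `N` is a one-sided collar of `e` in the complement of `F`. -/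
structure IsCollar (F e N : Set (ℝ × ℝ)) : Prop where
  isConnected : IsConnected N
  disjoint : Disjoint N F
  subset_closure : e ⊆ closure N

/-- The collars lie strictly above and below the graph, at height less than the distance `d` to the
rest of the sides: they avoid the edge by being off the graph and the other sides by the choice of
`d`. -/
theorem IsPolyEdge.exists_collars {𝒮 : Set (Set (ℝ × ℝ))} {θ : ℝ} {p : Polynomial ℝ} {J : Set ℝ}
    (h : IsPolyEdge 𝒮 θ p J) :
    ∃ N₁ N₂, IsCollar (⋃₀ 𝒮) (polyCurve θ p '' J) N₁ ∧ IsCollar (⋃₀ 𝒮) (polyCurve θ p '' J) N₂ ∧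
      IsOpen (N₁ ∪ N₂ ∪ polyCurve θ p '' J) := by
  obtain ⟨d, hdc, hdp, hd⟩ := h.isClosed_sdiff.exists_continuous_radius
  set e := polyCurve θ p '' J with he
  have hpos {t} (ht : t ∈ J) : 0 < d (polyCurve θ p t) :=
    hdp _ fun hc => hc.2 (mem_image_of_mem _ ht)
  let Φ (σ : ℝ) (w : ℝ × ℝ) : ℝ × ℝ :=
    rotPoint θ w.1 (p.eval w.1 + σ * (w.2 * d (polyCurve θ p w.1)))
  have hΦ (σ : ℝ) : Continuous (Φ σ) := by
    simp only [Φ, rotPoint]; fun_prop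
  let N (σ : ℝ) := Φ σ '' (J ×ˢ Ioo 0 1)
  have key (σ : ℝ) (hσ : |σ| = 1) : IsCollar (⋃₀ 𝒮) e (N σ) := by
    refine ⟨⟨(h.nonempty.prod (nonempty_Ioo.2 one_pos)).image _,
      (h.ordConnected.isPreconnected.prod isPreconnected_Ioo).image _ (hΦ σ).continuousOn⟩, ?_, ?_⟩
    · refine disjoint_left.2 ?_
      rintro _ ⟨⟨t, u⟩, ⟨ht, hu⟩, rfl⟩ hF
      have hdt := hpos ht
      by_cases hm : Φ σ (t, u) ∈ e
      · have := (mem_image_polyCurve.1 hm).2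
        simp only [Φ, rotSnd_rotPoint, rotFst_rotPoint, add_eq_left, mul_eq_zero] at this
        rcases this with h0 | h0 | h0
        · simp [h0] at hσ
        · exact hu.1.ne' h0
        · exact hdt.ne' h0
      · have h1 := hd (polyCurve θ p t) _ ⟨hF, hm⟩
        have h2 := dist_rotPoint_le θ t (p.eval t + σ * (u * d (polyCurve θ p t))) (p.eval t)
        rw [add_sub_cancel_left, abs_mul, hσ, one_mul, abs_of_pos (mul_pos hu.1 hdt)] at h2
        have h3 := h1.trans h2
        have := mul_lt_of_lt_one_left hdt hu.2
        linarith
    · rintro _ ⟨t, ht, rfl⟩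
      have h0 : polyCurve θ p t = Φ σ (t, 0) := by simp [Φ, polyCurve_eq_rotPoint]
      rw [h0]
      refine image_closure_subset_closure_image (hΦ σ) (mem_image_of_mem _ ?_)
      rw [closure_prod_eq, closure_Ioo zero_ne_one]
      exact ⟨subset_closure ht, left_mem_Icc.2 zero_le_one⟩
  refine ⟨N 1, N (-1), key 1 (by simp), key (-1) (by simp), ?_⟩
  -- Together with the edge, the collars fill a strip cut out by open conditions.
  have hset : N 1 ∪ N (-1) ∪ e = {z | rotFst θ z ∈ J} ∩
      {z | |rotSnd θ z - p.eval (rotFst θ z)| < d (polyCurve θ p (rotFst θ z))} := by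
    ext z
    constructor
    · have hN (σ : ℝ) (hσ : |σ| = 1) (hz : z ∈ N σ) : z ∈ {z | rotFst θ z ∈ J} ∩
          {z | |rotSnd θ z - p.eval (rotFst θ z)| < d (polyCurve θ p (rotFst θ z))} := by
        obtain ⟨⟨t, u⟩, ⟨ht, hu⟩, rfl⟩ := hz
        have hdt := hpos ht
        simp only [Φ, mem_inter_iff, mem_ofPred_eq, rotFst_rotPoint, rotSnd_rotPoint]
        refine ⟨ht, ?_⟩
        rw [add_sub_cancel_left, abs_mul, hσ, one_mul, abs_of_pos (mul_pos hu.1 hdt)]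
        exact mul_lt_of_lt_one_left hdt hu.2
      rintro ((hz | hz) | hz)
      · exact hN 1 (by simp) hz
      · exact hN (-1) (by simp) hz
      · obtain ⟨h1, h2⟩ := mem_image_polyCurve.1 hz
        refine ⟨h1, ?_⟩
        simp only [mem_ofPred_eq, h2, sub_self, abs_zero]
        exact hpos h1
    · rintro ⟨h1, h2⟩
      simp only [mem_ofPred_eq] at h1 h2
      have hdt := hpos h1
      have hN (σ : ℝ) (hσ : σ * σ = 1) (hlt : 0 < σ * (rotSnd θ z - p.eval (rotFst θ z)))
          (hle : σ * (rotSnd θ z - p.eval (rotFst θ z)) < d (polyCurve θ p (rotFst θ z))) :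
          z ∈ N σ := by
        refine ⟨(rotFst θ z, σ * (rotSnd θ z - p.eval (rotFst θ z)) /
          d (polyCurve θ p (rotFst θ z))), ⟨h1, div_pos hlt hdt, (div_lt_one hdt).2 hle⟩, ?_⟩
        simp only [Φ]
        rw [div_mul_cancel₀ _ hdt.ne', ← mul_assoc, hσ, one_mul, add_sub_cancel, rotPoint_rot]
      rw [abs_lt] at h2
      rcases lt_trichotomy (rotSnd θ z - p.eval (rotFst θ z)) 0 with hs | hs | hs
      · exact Or.inl (Or.inr (hN (-1) (by norm_num) (by linarith) (by linarith)))
      · exact Or.inr (mem_image_polyCurve.2 ⟨h1, sub_eq_zero.1 hs⟩)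
      · exact Or.inl (Or.inl (hN 1 (by norm_num) (by linarith) (by linarith)))
  rw [hset]
  refine (h.isOpen.preimage (continuous_rotFst θ)).inter (isOpen_lt ?_ ?_) <;> fun_prop

/-- An open set whose frontier lies in `F` and meets `e` contains a collar of `e`. -/
theorem IsCollar.subset_or_subset {F e N₁ N₂ U : Set (ℝ × ℝ)} (h₁ : IsCollar F e N₁)
    (h₂ : IsCollar F e N₂) (ho : IsOpen (N₁ ∪ N₂ ∪ e)) (hU : IsOpen U) (hUF : frontier U ⊆ F)
    (hne : (e ∩ closure U).Nonempty) : N₁ ⊆ U ∨ N₂ ⊆ U := by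
  by_contra! hc
  have hd₁ := (h₁.isConnected.isPreconnected.subset_or_disjoint_of_disjoint_frontier
    (h₁.disjoint.mono_right hUF)).resolve_left hc.1
  have hd₂ := (h₂.isConnected.isPreconnected.subset_or_disjoint_of_disjoint_frontier
    (h₂.disjoint.mono_right hUF)).resolve_left hc.2
  obtain ⟨x, hxe, hxU⟩ := hne
  obtain ⟨y, hyN, hyU⟩ := mem_closure_iff.1 hxU _ ho (Or.inr hxe)
  rcases hyN with (hy | hy) | hy
  · exact disjoint_left.1 hd₁ hy hyU
  · exact disjoint_left.1 hd₂ hy hyU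
  · obtain ⟨z, hzU, hzN⟩ := mem_closure_iff.1 (h₁.subset_closure hy) U hU hyU
    exact disjoint_left.1 hd₁ hzN hzU

/-! ### Components and punctured balls -/

/-- A frontier point inside `X` has an open component that meets the given one, hence equals it; but
an open set misses its frontier. -/
theorem IsOpen.disjoint_frontier_connectedComponentIn {α : Type*} [TopologicalSpace α]
    [LocallyConnectedSpace α] {X : Set α} (hX : IsOpen X) (x : α) :
    Disjoint X (frontier (connectedComponentIn X x)) := by
  refine disjoint_left.2 fun y hy hfr => ?_
  have ho : IsOpen (connectedComponentIn X x) := hX.connectedComponentIn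
  obtain ⟨z, hzy, hzx⟩ := mem_closure_iff.1 hfr.1 _ hX.connectedComponentIn
    (mem_connectedComponentIn hy)
  rw [ho.frontier_eq] at hfr
  refine hfr.2 ?_
  rw [connectedComponentIn_eq hzx, ← connectedComponentIn_eq hzy]
  exact mem_connectedComponentIn hy

/-- A finite union of connected sets has finitely many components, each of them the union of the
sets that it contains. -/
theorem componentsOf_sUnion {𝒜 : Set (Set (ℝ × ℝ))} (hf : 𝒜.Finite)
    (hc : ∀ A ∈ 𝒜, IsConnected A) :
    (componentsOf (⋃₀ 𝒜)).Finite ∧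
      ∀ C ∈ componentsOf (⋃₀ 𝒜), C = ⋃₀ {A ∈ 𝒜 | A ⊆ C} ∧
        ⋃₀ 𝒜 \ C = ⋃₀ {A ∈ 𝒜 | ¬ A ⊆ C} := by
  have hsub {A} (hA : A ∈ 𝒜) {x} (hx : x ∈ A) : A ⊆ connectedComponentIn (⋃₀ 𝒜) x :=
    (hc A hA).isPreconnected.subset_connectedComponentIn hx (subset_sUnion_of_mem hA)
  have hsub' {A} (hA : A ∈ 𝒜) {x z} (hx : x ∈ A) (hxz : x ∈ connectedComponentIn (⋃₀ 𝒜) z) :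
      A ⊆ connectedComponentIn (⋃₀ 𝒜) z := by
    rw [connectedComponentIn_eq hxz]; exact hsub hA hx
  constructor
  · choose! f hf' using fun A hA => (hc A hA).nonempty
    refine (hf.image fun A => connectedComponentIn (⋃₀ 𝒜) (f A)).subset ?_
    rintro _ ⟨x, ⟨A, hA, hx⟩, rfl⟩
    exact ⟨A, hA, (connectedComponentIn_eq (hsub hA hx (hf' A hA))).symm⟩
  · rintro _ ⟨x, -, rfl⟩
    refine ⟨Subset.antisymm (fun y hy => ?_) (sUnion_subset fun A hA => hA.2), ?_⟩
    · obtain ⟨A, hA, hyA⟩ := connectedComponentIn_subset _ _ hy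
      exact ⟨A, ⟨hA, hsub' hA hyA hy⟩, hyA⟩
    · ext y
      constructor
      · rintro ⟨⟨A, hA, hyA⟩, hy⟩
        exact ⟨A, ⟨hA, fun h => hy (h hyA)⟩, hyA⟩
      · rintro ⟨A, ⟨hA, hn⟩, hyA⟩
        exact ⟨⟨A, hA, hyA⟩, fun hy => hn (hsub' hA hyA hy)⟩

theorem one_lt_rank_real_prod : 1 < Module.rank ℝ (ℝ × ℝ) := by
  rw [← Module.finrank_eq_rank, Module.finrank_prod, Module.finrank_self]
  norm_num

theorem isConnected_ball_sdiff_singleton (c : ℝ × ℝ) {r : ℝ} (hr : 0 < r) :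
    IsConnected (ball c r \ {c}) := by
  have hdense := (dense_compl_singleton c).inter_open_nonempty _ isOpen_ball ⟨c, mem_ball_self hr⟩
  refine ⟨by rwa [Set.sdiff_eq], ?_⟩
  -- Radial contraction of the plane onto the ball, carrying the connected set `{0}ᶜ` onto the
  -- punctured ball.
  let f : ℝ × ℝ → ℝ × ℝ := fun x => c + (r / (1 + ‖x‖)) • x
  have hf : Continuous f := by
    have : ∀ x : ℝ × ℝ, 1 + ‖x‖ ≠ 0 := fun x => by positivity
    simp only [f]
    fun_prop (disch := assumption)
  have hset : ball c r \ {c} = f '' {0}ᶜ := by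
    ext z
    constructor
    · rintro ⟨hz, hzc⟩
      rw [mem_ball, dist_eq_norm] at hz
      have hpos : 0 < r - ‖z - c‖ := by linarith
      have hn : 1 + ‖z - c‖ / (r - ‖z - c‖) = r / (r - ‖z - c‖) := by field_simp; ring
      refine ⟨(1 / (r - ‖z - c‖)) • (z - c), ?_, ?_⟩
      · simp only [mem_compl_iff, mem_singleton_iff, smul_eq_zero, not_or]
        exact ⟨by positivity, sub_ne_zero.2 hzc⟩
      · simp only [f, norm_smul, Real.norm_eq_abs, abs_of_pos (one_div_pos.2 hpos)]
        rw [one_div_mul_eq_div, hn, smul_smul,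
          show r / (r / (r - ‖z - c‖)) * (1 / (r - ‖z - c‖)) = 1 by field_simp]
        simp
    · rintro ⟨x, hx, rfl⟩
      have hx0 : 0 < ‖x‖ := norm_pos_iff.2 hx
      refine ⟨?_, ?_⟩
      · rw [mem_ball, dist_eq_norm]
        simp only [f, add_sub_cancel_left, norm_smul, norm_div, Real.norm_eq_abs, abs_of_pos hr]
        rw [abs_of_pos (by positivity), div_mul_eq_mul_div, div_lt_iff₀ (by positivity)]
        nlinarith
      · simp only [f, mem_singleton_iff, add_eq_left, smul_eq_zero, not_or]
        exact ⟨by positivity, hx⟩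
  rw [hset]
  exact (isConnected_compl_singleton_of_one_lt_rank one_lt_rank_real_prod
    0).isPreconnected.image _ hf.continuousOn

/-- Pairwise disjoint sets, each containing a member of a fixed finite family of nonempty sets, are
finite in number. -/
theorem Set.Finite.of_pairwiseDisjoint_of_exists_subset {α : Type*} {𝒰 𝒢 : Set (Set α)}
    (h𝒢 : 𝒢.Finite) (hne : ∀ G ∈ 𝒢, G.Nonempty) (hd : 𝒰.PairwiseDisjoint id)
    (h : ∀ U ∈ 𝒰, ∃ G ∈ 𝒢, G ⊆ U) : 𝒰.Finite := by
  choose! g hg hgU using h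
  refine Finite.of_finite_image (f := g) (h𝒢.subset (image_subset_iff.2 hg)) fun U hU W hW hUW => ?_
  obtain ⟨x, hx⟩ := hne _ (hg U hU)
  exact hd.elim_set hU hW x (hgU U hU hx) (hgU W hW (hUW ▸ hx))

/-! ### Frontiers of type II regions and of their unions -/

theorem closure_image_polyCurve (θ : ℝ) (p : Polynomial ℝ) (J : Set ℝ) :
    closure (polyCurve θ p '' J) = polyCurve θ p '' closure J :=
  Subset.antisymm (closure_minimal (image_mono subset_closure)
    (isClosed_image_polyCurve θ p isClosed_closure))
    (image_closure_subset_closure_image (continuous_polyCurve θ p))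

theorem IsPolyEdge.isPolyArc_closure {𝒮 : Set (Set (ℝ × ℝ))} {θ : ℝ} {p : Polynomial ℝ}
    {J : Set ℝ} (h : IsPolyEdge 𝒮 θ p J) : IsPolyArc (closure (polyCurve θ p '' J)) := by
  refine ⟨θ, p, closure J, h.ordConnected.isPreconnected.closure.ordConnected, isClosed_closure, ?_,
    closure_image_polyCurve θ p J⟩
  obtain ⟨x, hx⟩ := h.nonempty
  exact (infinite_of_mem_nhds x (h.isOpen.mem_nhds hx)).nontrivial.mono subset_closure

theorem IsTypeII.isOpen {X : Set (ℝ × ℝ)} {𝒮 : Set (Set (ℝ × ℝ))} (h : IsTypeII X 𝒮) :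
    IsOpen X := by
  obtain ⟨T, -, rfl⟩ := h
  rw [self_sdiff_frontier]
  exact isOpen_interior

theorem IsTypeII.frontier_subset {X : Set (ℝ × ℝ)} {𝒮 : Set (Set (ℝ × ℝ))} (h : IsTypeII X 𝒮) :
    frontier X ⊆ ⋃₀ 𝒮 := by
  obtain ⟨T, hT, rfl⟩ := h
  rw [self_sdiff_frontier, ← hT.frontier_eq]
  exact frontier_interior_subset

theorem IsTypeII.disjoint_sUnion {X : Set (ℝ × ℝ)} {𝒮 : Set (Set (ℝ × ℝ))} (h : IsTypeII X 𝒮) :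
    Disjoint X (⋃₀ 𝒮) := by
  obtain ⟨T, hT, rfl⟩ := h
  rw [← hT.frontier_eq]
  exact disjoint_sdiff_left

/-- Since `T` is closed, it contains `c` and so the whole ball. An arbitrary open set, such as a
punctured disc, lacks this property. -/
theorem IsTypeII.mem_of_punctured_ball_subset {X : Set (ℝ × ℝ)} {𝒮 : Set (Set (ℝ × ℝ))}
    (h : IsTypeII X 𝒮) {c : ℝ × ℝ} {r : ℝ} (hr : 0 < r) (hc : c ∈ closure X)
    (hb : ball c r \ {c} ⊆ X) : c ∈ X := by
  obtain ⟨T, hT, rfl⟩ := h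
  rw [self_sdiff_frontier] at *
  refine mem_interior.2 ⟨ball c r, fun z hz => ?_, isOpen_ball, mem_ball_self hr⟩
  by_cases hzc : z = c
  · rw [hzc]
    exact closure_minimal interior_subset hT.isClosed hc
  · exact interior_subset (hb ⟨hz, hzc⟩)

/-- An isolated frontier point of a subset of a finite union of type II regions that lies
outside the union is a frontier point of two of the regions. -/
theorem exists_mem_frontier_inter_frontier {ι : Type*} {X : ι → Set (ℝ × ℝ)}
    {𝒮 : ι → Set (Set (ℝ × ℝ))} [Finite ι] (hX : ∀ i, IsTypeII (X i) (𝒮 i))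
    {U : Set (ℝ × ℝ)} (hUX : U ⊆ ⋃ i, X i) {c : ℝ × ℝ} (hc : c ∈ frontier U)
    (hcX : c ∉ ⋃ i, X i) (hiso : IsClosed (frontier U \ {c})) :
    ∃ i j, i ≠ j ∧ c ∈ frontier (X i) ∩ frontier (X j) := by
  have hfr {i} (hi : c ∈ closure (X i)) : c ∈ frontier (X i) := by
    rw [(hX i).isOpen.frontier_eq]
    exact ⟨hi, fun h => hcX (mem_iUnion_of_mem i h)⟩
  obtain ⟨i, hi⟩ : ∃ i, c ∈ closure (X i) := by
    have := closure_mono hUX hc.1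
    rwa [closure_iUnion_of_finite, mem_iUnion] at this
  by_contra! hno
  have hcj : ∀ j, j ≠ i → c ∉ closure (X j) := fun j hj hcj => hno i j hj.symm ⟨hfr hi, hfr hcj⟩
  -- A ball around `c` avoiding this set meets no region but `X i`, and no point of `frontier U` but
  -- `c`.
  have hcl : IsClosed ((frontier U \ {c}) ∪ ⋃ j : {j // j ≠ i}, closure (X j)) :=
    hiso.union (isClosed_iUnion_of_finite fun _ => isClosed_closure)
  have hcn : c ∈ ((frontier U \ {c}) ∪ ⋃ j : {j // j ≠ i}, closure (X j))ᶜ := by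
    simp only [mem_compl_iff, mem_union, mem_sdiff, mem_singleton_iff, not_true_eq_false, and_false,
      mem_iUnion, false_or, not_exists]
    exact fun j => hcj j j.2
  obtain ⟨r, hr, hball⟩ := Metric.isOpen_iff.1 hcl.isOpen_compl c hcn
  have hdisj : Disjoint (ball c r \ {c}) (frontier U) := disjoint_left.2 fun z hz hzU =>
    hball hz.1 (Or.inl ⟨hzU, hz.2⟩)
  have hbU : ball c r \ {c} ⊆ U := by
    refine ((isConnected_ball_sdiff_singleton c
      hr).isPreconnected.subset_or_disjoint_of_disjoint_frontier hdisj).resolve_right fun hd => ?_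
    obtain ⟨z, hzb, hzU⟩ := mem_closure_iff.1 hc.1 _ isOpen_ball (mem_ball_self hr)
    refine disjoint_left.1 hd ⟨hzb, fun hzc => hcX (hUX ?_)⟩ hzU
    rw [mem_singleton_iff] at hzc
    rwa [← hzc]
  refine hcX (mem_iUnion_of_mem i ((hX i).mem_of_punctured_ball_subset hr hi fun z hz => ?_))
  obtain ⟨j, hj⟩ := mem_iUnion.1 (hUX (hbU hz))
  by_cases hji : j = i
  · rwa [← hji]
  · exact (hball hz.1 (Or.inr (mem_iUnion.2 ⟨⟨j, hji⟩, subset_closure hj⟩))).elim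

/-- Let `U` be an open subset of a union of type II regions, with frontier outside this union. An edge
that meets `frontier U` lies in it, as well as in the frontier and in a side of one of the regions. -/
theorem IsPolyEdge.exists_frontier_side {ι : Type*} {X : ι → Set (ℝ × ℝ)}
    {𝒮 : ι → Set (Set (ℝ × ℝ))}
    (hX : ∀ i, IsTypeII (X i) (𝒮 i)) {θ : ℝ}
    {p : Polynomial ℝ} {J : Set ℝ} (h : IsPolyEdge (⋃ i, 𝒮 i) θ p J) {U : Set (ℝ × ℝ)}
    (hU : IsOpen U) (hUX : U ⊆ ⋃ i, X i) (hUF : frontier U ⊆ ⋃₀ ⋃ i, 𝒮 i)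
    (hXU : Disjoint (⋃ i, X i) (frontier U))
    (hne : (polyCurve θ p '' J ∩ frontier U).Nonempty) :
    polyCurve θ p '' J ⊆ frontier U ∧ ∃ i, polyCurve θ p '' J ⊆ frontier (X i) ∧
      ∃ S ∈ 𝒮 i, polyCurve θ p '' J ⊆ S := by
  obtain ⟨N₁, N₂, h₁, h₂, ho⟩ := h.exists_collars
  set e := polyCurve θ p '' J
  have hpc : IsPreconnected e :=
    h.ordConnected.isPreconnected.image _ (continuous_polyCurve θ p).continuousOn
  have hsF (i : ι) : ⋃₀ 𝒮 i ⊆ ⋃₀ ⋃ i, 𝒮 i := sUnion_mono (subset_iUnion _ _)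
  -- An edge inside a side of `X i` misses `X i`; any other edge misses all its sides, hence its
  -- frontier.
  have heX (i : ι) : e ⊆ X i ∨ Disjoint e (X i) := by
    by_cases hS : ∃ S ∈ 𝒮 i, e ⊆ S
    · obtain ⟨S, hS, heS⟩ := hS
      exact Or.inr ((hX i).disjoint_sUnion.symm.mono_left (heS.trans (subset_sUnion_of_mem hS)))
    · refine hpc.subset_or_disjoint_of_disjoint_frontier (Disjoint.mono_right (hX i).frontier_subset
        (disjoint_sUnion_right.2 fun S hS' => ?_))
      exact (h.subset_or_disjoint S (mem_iUnion_of_mem i hS')).resolve_left fun hc =>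
        hS ⟨S, hS', hc⟩
  obtain ⟨x, hxe, hxU⟩ := hne
  have hdis (i : ι) : Disjoint e (X i) := (heX i).resolve_left fun hc =>
    disjoint_left.1 hXU (mem_iUnion_of_mem i (hc hxe)) hxU
  obtain ⟨N, hN, hNU⟩ : ∃ N, IsCollar (⋃₀ ⋃ i, 𝒮 i) e N ∧ N ⊆ U := by
    rcases h₁.subset_or_subset h₂ ho hU hUF ⟨x, hxe, hxU.1⟩ with hc | hc
    exacts [⟨_, h₁, hc⟩, ⟨_, h₂, hc⟩]
  obtain ⟨y, hy⟩ := hN.isConnected.nonempty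
  obtain ⟨i, hyi⟩ := mem_iUnion.1 (hUX (hNU hy))
  have hNi : N ⊆ X i := (hN.isConnected.isPreconnected.subset_or_disjoint_of_disjoint_frontier
    (hN.disjoint.mono_right ((hX i).frontier_subset.trans (hsF i)))).resolve_right fun hd =>
      disjoint_left.1 hd hy hyi
  have hei : e ⊆ frontier (X i) := fun z hz => by
    rw [(hX i).isOpen.frontier_eq]
    exact ⟨closure_mono hNi (hN.subset_closure hz), disjoint_left.1 (hdis i) hz⟩
  refine ⟨fun z hz => ?_, i, hei, ?_⟩
  · rw [hU.frontier_eq]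
    refine ⟨closure_mono hNU (hN.subset_closure hz), fun hzU => ?_⟩
    obtain ⟨j, hj⟩ := mem_iUnion.1 (hUX hzU)
    exact disjoint_left.1 (hdis j) hz hj
  · obtain ⟨S, hS, hxS⟩ := (hX i).frontier_subset (hei hxe)
    exact ⟨S, hS, (h.subset_or_disjoint S (mem_iUnion_of_mem i hS)).resolve_right fun hd =>
      disjoint_left.1 hd hxe hxS⟩

/-- A connected union of a finite family of closed sets and a finite set of points is the union of
the family or a single point. -/
theorem IsPreconnected.eq_sUnion_or_singleton {α : Type*} [TopologicalSpace α] [T1Space α]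
    {C V : Set α} {𝒜 : Set (Set α)} (hC : IsPreconnected C) (h𝒜 : 𝒜.Finite)
    (hcl : ∀ A ∈ 𝒜, IsClosed A) (hV : V.Finite) (hCV : C = ⋃₀ 𝒜 ∪ V) :
    C = ⋃₀ 𝒜 ∨ ∃ c ∈ V, C = {c} := by
  by_cases hsub : V ⊆ ⋃₀ 𝒜
  · exact Or.inl (by rw [hCV, union_eq_left.2 hsub])
  right
  obtain ⟨c, hc, hcA⟩ := not_subset.1 hsub
  refine ⟨c, hc, ?_⟩
  have hcC : c ∈ C := hCV ▸ Or.inr hc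
  by_contra hne
  obtain ⟨z, hz, hzc⟩ : ∃ z ∈ C, z ≠ c := by
    by_contra! hall
    exact hne (Subset.antisymm hall (singleton_subset_iff.2 hcC))
  have hcov : C ⊆ {c} ∪ (⋃₀ 𝒜 ∪ V \ {c}) := by
    rw [hCV]
    rintro w (hw | hw)
    · exact Or.inr (Or.inl hw)
    · by_cases hwc : w = c
      · exact Or.inl hwc
      · exact Or.inr (Or.inr ⟨hw, hwc⟩)
  -- A second point of `C` would split it into two disjoint closed parts, `{c}` and the rest.
  obtain ⟨w, -, hw1, hw2⟩ := isPreconnected_closed_iff.1 hC {c} (⋃₀ 𝒜 ∪ V \ {c})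
    isClosed_singleton ((sUnion_eq_biUnion ▸ h𝒜.isClosed_biUnion hcl).union hV.sdiff.isClosed) hcov ⟨c, hcC, rfl⟩
    ⟨z, hz, (hcov hz).resolve_left hzc⟩
  rw [mem_singleton_iff] at hw1
  subst hw1
  exact hw2.elim hcA fun h => h.2 rfl

theorem componentsOf_pairwiseDisjoint (B : Set (ℝ × ℝ)) : (componentsOf B).PairwiseDisjoint id := by
  rintro _ ⟨x, -, rfl⟩ _ ⟨y, -, rfl⟩ hne
  refine disjoint_left.2 fun z hz hz' => hne ?_
  simp only [id] at hz hz'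
  rw [connectedComponentIn_eq hz, connectedComponentIn_eq hz']

theorem sUnion_componentsOf (B : Set (ℝ × ℝ)) : ⋃₀ componentsOf B = B := by
  refine Subset.antisymm (sUnion_subset ?_) fun x hx =>
    ⟨_, ⟨x, hx, rfl⟩, mem_connectedComponentIn hx⟩
  rintro _ ⟨x, -, rfl⟩
  exact connectedComponentIn_subset _ _

/-- A nonempty open set whose frontier lies in a finite set contains the complement of that set. -/
theorem IsOpen.compl_frontier_subset_of_finite {U V : Set (ℝ × ℝ)} (hne : U.Nonempty)
    (hU : IsOpen U) (hV : V.Finite) (hUV : frontier U ⊆ V) : Vᶜ ⊆ U := by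
  refine ((hV.countable.isConnected_compl_of_one_lt_rank
    one_lt_rank_real_prod).isPreconnected.subset_or_disjoint_of_disjoint_frontier
      (disjoint_compl_left.mono_right hUV)).resolve_right fun hd => ?_
  obtain ⟨x, hxU, hxV⟩ := (hV.countable.dense_compl ℝ).inter_open_nonempty U hU hne
  exact disjoint_left.1 hd hxV hxU

/-! ### The decomposition of the union -/

theorem proposition4p8 (n : ℕ) (X : Fin n → Set (ℝ × ℝ)) (𝒮 : Fin n → Set (Set (ℝ × ℝ)))
    (hX : ∀ i, IsTypeII (X i) (𝒮 i)) :
    ∃ 𝒰 : Set (Set (ℝ × ℝ)),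
      𝒰.Finite ∧ 𝒰.PairwiseDisjoint id ∧ (⋃ i, X i) = ⋃₀ 𝒰 ∧
      ∀ U ∈ 𝒰, IsOpen U ∧ IsConnected U ∧
        (componentsOf (frontier U)).Finite ∧
        ∀ C ∈ componentsOf (frontier U),
          (∃ 𝒜 : Set (Set (ℝ × ℝ)), 𝒜.Finite ∧ C = ⋃₀ 𝒜 ∧
            ∀ A ∈ 𝒜, IsPolyArc A ∧ ∃ i, A ⊆ frontier (X i) ∧ ∃ S ∈ 𝒮 i, A ⊆ S) ∨
          (∃ i j, i ≠ j ∧ ∃ c ∈ frontier (X i) ∩ frontier (X j), C = {c}) := by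
  have hfin : (⋃ i, 𝒮 i).Finite := finite_iUnion fun i => by
    obtain ⟨T, hT, -⟩ := hX i
    exact hT.finite_sides
  have harc' (i : Fin n) : ∀ S ∈ 𝒮 i, IsPolyArc S := by
    obtain ⟨T, hT, -⟩ := hX i
    exact hT.isPolyArc_of_mem
  have harc : ∀ S ∈ ⋃ i, 𝒮 i, IsPolyArc S := fun S hS => by
    obtain ⟨i, hi⟩ := mem_iUnion.1 hS
    exact harc' i S hi
  obtain ⟨V, ℰ, hV, hℰ, hcov, hedge⟩ := exists_polyEdge_decomposition hfin harc
  have hXo : IsOpen (⋃ i, X i) := isOpen_iUnion fun i => (hX i).isOpen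
  have hUo : ∀ U ∈ componentsOf (⋃ i, X i), IsOpen U := by
    rintro _ ⟨x, -, rfl⟩
    exact hXo.connectedComponentIn
  have hUc : ∀ U ∈ componentsOf (⋃ i, X i), IsConnected U := by
    rintro _ ⟨x, hx, rfl⟩
    exact isConnected_connectedComponentIn_iff.2 hx
  have hUX : ∀ U ∈ componentsOf (⋃ i, X i), U ⊆ ⋃ i, X i := by
    rintro _ ⟨x, -, rfl⟩
    exact connectedComponentIn_subset _ _
  have hXU : ∀ U ∈ componentsOf (⋃ i, X i), Disjoint (⋃ i, X i) (frontier U) := by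
    rintro _ ⟨x, -, rfl⟩
    exact hXo.disjoint_frontier_connectedComponentIn x
  have hUF : ∀ U ∈ componentsOf (⋃ i, X i), frontier U ⊆ ⋃₀ ⋃ i, 𝒮 i := fun U hU z hz => by
    have hz' := closure_mono (hUX U hU) hz.1
    rw [closure_iUnion_of_finite, mem_iUnion] at hz'
    obtain ⟨i, hi⟩ := hz'
    refine sUnion_mono (subset_iUnion 𝒮 i) ((hX i).frontier_subset ?_)
    rw [(hX i).isOpen.frontier_eq]
    exact ⟨hi, fun h => disjoint_left.1 (hXU U hU) (mem_iUnion_of_mem i h) hz⟩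
  have hcollar : ∀ e ∈ ℰ, ∃ N₁ N₂, IsCollar (⋃₀ ⋃ i, 𝒮 i) e N₁ ∧ IsCollar (⋃₀ ⋃ i, 𝒮 i) e N₂ ∧
      IsOpen (N₁ ∪ N₂ ∪ e) := by
    rintro e he
    obtain ⟨θ, p, J, rfl, h⟩ := hedge e he
    exact h.exists_collars
  choose! N₁ N₂ hN₁ hN₂ hNo using hcollar
  refine ⟨componentsOf (⋃ i, X i), ?_, componentsOf_pairwiseDisjoint _,
    (sUnion_componentsOf _).symm, fun U hU => ⟨hUo U hU, hUc U hU, ?_⟩⟩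
  · refine Set.Finite.of_pairwiseDisjoint_of_exists_subset (𝒢 := {Vᶜ} ∪ (N₁ '' ℰ ∪ N₂ '' ℰ))
      ((finite_singleton _).union ((hℰ.image _).union (hℰ.image _))) ?_
      (componentsOf_pairwiseDisjoint _) fun U hU => ?_
    · rintro _ (rfl | ⟨e, he, rfl⟩ | ⟨e, he, rfl⟩)
      · exact (hV.countable.dense_compl ℝ).nonempty
      · exact (hN₁ e he).isConnected.nonempty
      · exact (hN₂ e he).isConnected.nonempty
    · by_cases hUV : frontier U ⊆ V
      · exact ⟨_, Or.inl rfl,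
          (hUo U hU).compl_frontier_subset_of_finite (hUc U hU).nonempty hV hUV⟩
      · obtain ⟨x, hxU, hxV⟩ := not_subset.1 hUV
        obtain ⟨e, he, hxe⟩ := (hcov (hUF U hU hxU)).resolve_left hxV
        rcases (hN₁ e he).subset_or_subset (hN₂ e he) (hNo e he) (hUo U hU) (hUF U hU)
          ⟨x, hxe, hxU.1⟩ with hc | hc
        · exact ⟨_, Or.inr (Or.inl ⟨e, he, rfl⟩), hc⟩
        · exact ⟨_, Or.inr (Or.inr ⟨e, he, rfl⟩), hc⟩
  · let 𝒜 : Set (Set (ℝ × ℝ)) := closure '' {e ∈ ℰ | (e ∩ frontier U).Nonempty}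
    let 𝒬 : Set (Set (ℝ × ℝ)) := (fun v => {v}) '' (V ∩ frontier U)
    have h𝒜f : 𝒜.Finite := (hℰ.subset (sep_subset _ _)).image _
    have h𝒜 : ∀ A ∈ 𝒜, IsPolyArc A ∧ A ⊆ frontier U ∧
        ∃ i, A ⊆ frontier (X i) ∧ ∃ S ∈ 𝒮 i, A ⊆ S := by
      rintro _ ⟨e, ⟨he, hne⟩, rfl⟩
      obtain ⟨θ, p, J, rfl, h⟩ := hedge e he
      obtain ⟨hsub, i, hi, S, hS, heS⟩ :=
        h.exists_frontier_side hX (hUo U hU) (hUX U hU) (hUF U hU) (hXU U hU) hne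
      exact ⟨h.isPolyArc_closure, closure_minimal hsub isClosed_frontier, i,
        closure_minimal hi isClosed_frontier, S, hS, closure_minimal heS (harc' i S hS).isClosed⟩
    have hfr : frontier U = ⋃₀ (𝒜 ∪ 𝒬) := by
      refine Subset.antisymm (fun x hx => ?_) (sUnion_subset ?_)
      · rcases hcov (hUF U hU hx) with hxV | ⟨e, he, hxe⟩
        · exact ⟨{x}, Or.inr ⟨x, ⟨hxV, hx⟩, rfl⟩, rfl⟩
        · exact ⟨closure e, Or.inl ⟨e, ⟨he, x, hxe, hx⟩, rfl⟩, subset_closure hxe⟩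
      · rintro A (hA | ⟨v, hv, rfl⟩)
        · exact (h𝒜 A hA).2.1
        · exact singleton_subset_iff.2 hv.2
    have hPf : (𝒜 ∪ 𝒬).Finite := h𝒜f.union ((hV.inter_of_left _).image _)
    have hcon : ∀ A ∈ 𝒜 ∪ 𝒬, IsConnected A := by
      rintro A (hA | ⟨v, -, rfl⟩)
      · exact (h𝒜 A hA).1.isConnected
      · exact isConnected_singleton
    have hclosed : ∀ A ∈ 𝒜 ∪ 𝒬, IsClosed A := by
      rintro A (hA | ⟨v, -, rfl⟩)
      · exact (h𝒜 A hA).1.isClosed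
      · exact isClosed_singleton
    obtain ⟨hfc, hcomp⟩ := componentsOf_sUnion hPf hcon
    rw [← hfr] at hfc hcomp
    refine ⟨hfc, fun C hC => ?_⟩
    obtain ⟨hCeq, hCd⟩ := hcomp C hC
    have hCsub : C ⊆ frontier U := by
      obtain ⟨x, -, rfl⟩ := hC
      exact connectedComponentIn_subset _ _
    have hCpre : IsPreconnected C := by
      obtain ⟨x, -, rfl⟩ := hC
      exact isPreconnected_connectedComponentIn
    have hCV : C = ⋃₀ {A ∈ 𝒜 | A ⊆ C} ∪ (V ∩ C) := by
      refine Subset.antisymm (fun x hx => ?_)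
        (union_subset (sUnion_subset fun A hA => hA.2) inter_subset_right)
      have hx' := hx
      rw [hCeq] at hx'
      obtain ⟨A, ⟨hA | ⟨v, hv, rfl⟩, hAC⟩, hxA⟩ := hx'
      · exact Or.inl ⟨A, ⟨hA, hAC⟩, hxA⟩
      · rw [mem_singleton_iff] at hxA
        exact Or.inr ⟨hxA ▸ hv.1, hx⟩
    rcases hCpre.eq_sUnion_or_singleton (h𝒜f.subset (sep_subset _ _))
      (fun A hA => (h𝒜 A hA.1).1.isClosed) (hV.inter_of_left _) hCV with hc | ⟨c, ⟨-, hcC⟩, hc⟩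
    · exact Or.inl ⟨_, h𝒜f.subset (sep_subset _ _), hc,
        fun A hA => ⟨(h𝒜 A hA.1).1, (h𝒜 A hA.1).2.2⟩⟩
    · right
      have hcX : c ∉ ⋃ i, X i := fun h => disjoint_left.1 (hXU U hU) h (hCsub hcC)
      -- Outside the component `{c}`, the frontier is the union of the remaining finitely many
      -- closed pieces.
      have hiso : IsClosed (frontier U \ {c}) := by
        rw [← hc, hCd, sUnion_eq_biUnion]
        exact (hPf.subset (sep_subset _ _)).isClosed_biUnion fun A hA => hclosed A hA.1
      obtain ⟨i, j, hij, hcij⟩ := exists_mem_frontier_inter_frontier hX (hUX U hU)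
        (hCsub hcC) hcX hiso
      exact ⟨i, j, hij, c, hcij, hc⟩
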